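/- Let $M$ be an $n$-dimensional (Hausdorff) manifold of class $C^\infty$ and let $\alpha,\beta$ be positive integers. A metallic structure (with parameters $\alpha,\beta$) on a $C^\infty$ manifold $N$ is a $C^\infty$ tensor field $\Psi$ of type $(1,1)$ on $N$ with $\Psi^2-\alpha\Psi-\beta I=0$. Let $\Psi$ be a $C^\infty$ tensor field of type $(1,1)$ on $M$. The complete lift $\Psi^C$ of $\Psi$ is the tensor field of type $(1,1)$ on the tangent bundle $TM$ which, in the coordinates $(x^h,y^h)$ of $TM$ induced by a chart $(x^h)$ of $M$, is given by $$\Psi^C=\begin{pmatrix}\Psi^h_i & 0\\ y^j\partial_j\Psi^h_i & \Psi^h_i\end{pmatrix}.$$ For a $C^\infty$ vector field $V$ on $M$, let $\beta_V:M\to TM$, $x\mapsto V(x)$. The cross-section determined by $V$ is the $n$-dimensional submanifold $\beta_V(M)$ of $TM$ (so that $\beta_V$ is a diffeomorphism of $M$ onto $\beta_V(M)$). The Lie derivative of $\Psi$ is $(L_V\Psi)X=[V,\Psi X]-\Psi[V,X]$ for $C^\infty$ vector fields $X$ on $M$. **Theorem 6.2.** Suppose that $\Psi$ is a metallic structure on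 $M$ with parameters $\alpha,\beta$ and that $L_V\Psi=0$ for a $C^\infty$ vector field $V$ on $M$. Then $\Psi^C$ leaves $\beta_V(M)$ invariant, i.e. $\Psi^C$ maps every vector tangent to $\beta_V(M)$ to a vector tangent to $\beta_V(M)$. Consequently there is exactly one field $\Psi^{C\#}$ of endomorphisms of the tangent spaces of $\beta_V(M)$ with $\Psi^{C\#}(w)=\Psi^C(w)$ for every vector $w$ tangent to $\beta_V(M)$ (the tensor field induced on $\beta_V(M)$ from $\Psi^C$), and $\Psi^{C\#}$ is a metallic structure on $\beta_V(M)$ with the same parameters $\alpha,\beta$: it is of class $C^\infty$ and $(\Psi^{C\#})^2-\alpha\Psi^{C\#}-\beta I=0$. -/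

import Mathlib

open Bundle Set Function
open scoped Manifold ContDiff Bundle

noncomputable section

/-- A (not necessarily smooth) field of endomorphisms of the tangent spaces of a manifold `N`,
i.e. a tensor field of type `(1, 1)`. -/
abbrev TensorField11 {E : Type*} [NormedAddCommGroup E] [NormedSpace ℝ E]
    {H : Type*} [TopologicalSpace H] (I : ModelWithCorners ℝ E H)
    (N : Type*) [TopologicalSpace N] [ChartedSpace H N] : Type _ :=
  ∀ x : N, TangentSpace I x →L[ℝ] TangentSpace I x

/-- `Ψ` is a `C^∞` tensor field of type `(1, 1)`: a smooth section of `Hom(TN, TN)`. -/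
def IsSmoothTensor {E : Type*} [NormedAddCommGroup E] [NormedSpace ℝ E]
    {H : Type*} [TopologicalSpace H] (I : ModelWithCorners ℝ E H)
    {N : Type*} [TopologicalSpace N] [ChartedSpace H N] [IsManifold I ∞ N]
    (Ψ : TensorField11 I N) : Prop :=
  ContMDiff I (I.prod 𝓘(ℝ, E →L[ℝ] E)) ∞
    (fun x => TotalSpace.mk' (E →L[ℝ] E)
      (E := fun x : N => TangentSpace I x →L[ℝ] TangentSpace I x) x (Ψ x))

/-- `Ψ` is a metallic structure on `N` with parameters `a`, `b`: these are positive integers and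
`Ψ` is a `C^∞` tensor field of type `(1, 1)` with `Ψ² - a Ψ - b I = 0`. -/
structure IsMetallic {E : Type*} [NormedAddCommGroup E] [NormedSpace ℝ E]
    {H : Type*} [TopologicalSpace H] (I : ModelWithCorners ℝ E H)
    {N : Type*} [TopologicalSpace N] [ChartedSpace H N] [IsManifold I ∞ N]
    (a b : ℕ) (Ψ : TensorField11 I N) : Prop where
  pos_a : 0 < a
  pos_b : 0 < b
  smooth : IsSmoothTensor I Ψ
  eq_zero : ∀ x : N, (Ψ x).comp (Ψ x) - (a : ℝ) • Ψ x
    - (b : ℝ) • ContinuousLinearMap.id ℝ (TangentSpace I x) = 0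

section Lifts

variable {n : ℕ} {M : Type*} [TopologicalSpace M] [ChartedSpace (EuclideanSpace ℝ (Fin n)) M]
  [IsManifold (𝓡 n) ∞ M]

/-- The type of `C^∞` vector fields on `M`. -/
abbrev SmoothVectorField (n : ℕ) (M : Type*) [TopologicalSpace M]
    [ChartedSpace (EuclideanSpace ℝ (Fin n)) M] [IsManifold (𝓡 n) ∞ M] : Type _ :=
  ContMDiffSection (𝓡 n) (EuclideanSpace ℝ (Fin n)) ∞ (TangentSpace (𝓡 n) : M → Type _)

/-- The Lie derivative `L_V Ψ` of a tensor field of type `(1, 1)`, applied to a vector field `X`: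
`(L_V Ψ) X = [V, Ψ X] - Ψ [V, X]`. -/
def lieDerivTensor (V : SmoothVectorField n M) (Ψ : TensorField11 (𝓡 n) M)
    (X : SmoothVectorField n M) (x : M) : TangentSpace (𝓡 n) x :=
  VectorField.mlieBracket (𝓡 n) (fun y => V y) (fun y => Ψ y (X y)) x
    - Ψ x (VectorField.mlieBracket (𝓡 n) (fun y => V y) (fun y => X y) x)

/-- The matrix `(Ψ^h_i)` of components of `Ψ` in the preferred chart of `M` at `x₀`, as a function
of the coordinates `z` of that chart. -/
def tensorComponents (Ψ : TensorField11 (𝓡 n) M) (x₀ : M) (z : EuclideanSpace ℝ (Fin n)) :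
    EuclideanSpace ℝ (Fin n) →L[ℝ] EuclideanSpace ℝ (Fin n) :=
  let x : M := (extChartAt (𝓡 n) x₀).symm z
  ContinuousLinearMap.inCoordinates (EuclideanSpace ℝ (Fin n)) (TangentSpace (𝓡 n) : M → Type _)
    (EuclideanSpace ℝ (Fin n)) (TangentSpace (𝓡 n) : M → Type _) x₀ x x₀ x (Ψ x)

/-- The complete lift `Ψ^C` of `Ψ` to the tangent bundle `TM`. For the induced coordinates
`(x^h, y^h)` of `TM` it is given by the block matrix with rows `(Ψ^h_i, 0)` and
`(y^j ∂_j Ψ^h_i, Ψ^h_i)`.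

At a point `p` of `TM` we use the coordinates of `TM` induced by the preferred chart of `M` at the
foot of `p`. In Mathlib, the tangent space of `TM` at `p` is by definition `ℝⁿ × ℝⁿ`, an element
being identified with its components in the preferred chart of `TM` at `p`, and that chart is the
one of the induced coordinates. Likewise `p.snd` is the list of the coordinates `y^h` of `p`. -/
def completeLift (Ψ : TensorField11 (𝓡 n) M) : TensorField11 (𝓡 n).tangent (TangentBundle (𝓡 n) M) :=
  fun p =>
    let x : EuclideanSpace ℝ (Fin n) := extChartAt (𝓡 n) p.proj p.proj
    let y : EuclideanSpace ℝ (Fin n) := p.snd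
    let A : EuclideanSpace ℝ (Fin n) →L[ℝ] EuclideanSpace ℝ (Fin n) :=
      tensorComponents Ψ p.proj x
    let dA : EuclideanSpace ℝ (Fin n) →L[ℝ] EuclideanSpace ℝ (Fin n) :=
      fderiv ℝ (tensorComponents Ψ p.proj) x y
    let π₁ := ContinuousLinearMap.fst ℝ (EuclideanSpace ℝ (Fin n)) (EuclideanSpace ℝ (Fin n))
    let π₂ := ContinuousLinearMap.snd ℝ (EuclideanSpace ℝ (Fin n)) (EuclideanSpace ℝ (Fin n))
    (show EuclideanSpace ℝ (Fin n) × EuclideanSpace ℝ (Fin n) →L[ℝ]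
        EuclideanSpace ℝ (Fin n) × EuclideanSpace ℝ (Fin n) from
      (A.comp π₁).prod (dA.comp π₁ + A.comp π₂))

/-- The map `β_V : M → TM`, `x ↦ V x`. -/
def crossMap (V : SmoothVectorField n M) (x : M) : TangentBundle (𝓡 n) M :=
  ⟨x, V x⟩

/-- The cross-section `β_V(M) ⊆ TM` determined by the vector field `V`. -/
def CrossSection (V : SmoothVectorField n M) : Set (TangentBundle (𝓡 n) M) :=
  range (crossMap V)

/-- `β_V` is a homeomorphism of `M` onto `β_V(M)` (with the subspace topology of `TM`); its
inverse is the restriction of the projection `TM → M`. -/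
def crossHomeo (V : SmoothVectorField n M) : M ≃ₜ CrossSection V where
  toFun x := ⟨crossMap V x, mem_range_self x⟩
  invFun q := q.1.proj
  left_inv _ := rfl
  right_inv := by
    rintro ⟨_, x, rfl⟩
    rfl
  continuous_toFun := V.contMDiff.continuous.subtype_mk _
  continuous_invFun :=
    (FiberBundle.continuous_proj (EuclideanSpace ℝ (Fin n))
      (TangentSpace (𝓡 n) : M → Type _)).comp continuous_subtype_val

/-- The charts of `β_V(M)`: the `x^h` serve as coordinates, i.e. the charts are those of `M`
composed with the homeomorphism `β_V(M) ≃ M`. Thus `β_V` is a diffeomorphism of `M` onto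
`β_V(M)`. -/
instance crossChartedSpace (V : SmoothVectorField n M) :
    ChartedSpace (EuclideanSpace ℝ (Fin n)) (CrossSection V) where
  atlas := {e | ∃ c ∈ atlas (EuclideanSpace ℝ (Fin n)) M,
    e = (crossHomeo V).symm.toOpenPartialHomeomorph.trans c}
  chartAt q := (crossHomeo V).symm.toOpenPartialHomeomorph.trans
    (chartAt (EuclideanSpace ℝ (Fin n)) ((crossHomeo V).symm q))
  mem_chart_source q := by simp
  chart_mem_atlas q := ⟨_, chart_mem_atlas _ _, rfl⟩

instance crossIsManifold (V : SmoothVectorField n M) : IsManifold (𝓡 n) ∞ (CrossSection V) where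
  compatible := by
    rintro _ _ ⟨c, hc, rfl⟩ ⟨c', hc', rfl⟩
    refine (contDiffGroupoid ∞ (𝓡 n)).mem_of_eqOnSource
      (HasGroupoid.compatible (G := contDiffGroupoid ∞ (𝓡 n)) hc hc') ?_
    refine ⟨?_, ?_⟩
    · ext z
      simp
    · intro z _
      simp

/-- The differential at `q` of the inclusion `β_V(M) ⊆ TM`. -/
def crossInclusionDeriv (V : SmoothVectorField n M) (q : CrossSection V) :
    TangentSpace (𝓡 n) q →L[ℝ] TangentSpace (𝓡 n).tangent (q : TangentBundle (𝓡 n) M) :=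
  mfderiv (𝓡 n) (𝓡 n).tangent (Subtype.val : CrossSection V → TangentBundle (𝓡 n) M) q

/-- A tensor field `Φ` of type `(1, 1)` on `TM` leaves `β_V(M)` invariant: it maps vectors of `TM`
tangent to `β_V(M)` to vectors tangent to `β_V(M)`. -/
def LeavesInvariant (V : SmoothVectorField n M)
    (Φ : TensorField11 (𝓡 n).tangent (TangentBundle (𝓡 n) M)) : Prop :=
  ∀ q : CrossSection V, ∀ w ∈ LinearMap.range (crossInclusionDeriv V q).toLinearMap,
    Φ q w ∈ LinearMap.range (crossInclusionDeriv V q).toLinearMap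

/-- The tensor field `Φ'` on `β_V(M)` is the one induced by the tensor field `Φ` on `TM`, that is,
the restriction of `Φ` to vectors tangent to `β_V(M)`. -/
def IsInducedTensor (V : SmoothVectorField n M)
    (Φ : TensorField11 (𝓡 n).tangent (TangentBundle (𝓡 n) M))
    (Φ' : TensorField11 (𝓡 n) (CrossSection V)) : Prop :=
  ∀ (q : CrossSection V) (w : TangentSpace (𝓡 n) q),
    crossInclusionDeriv V q (Φ' q w) = Φ q (crossInclusionDeriv V q w)

end Lifts

end

/-! In induced coordinates the vectors tangent to `β_V(M)` are the pairs `(w, DV w)`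
(`crossInclusionDeriv_apply`). The complete lift sends such a pair to `(Ψ w, (∂_V Ψ) w + Ψ (DV w))`,
which is tangent exactly when its second entry is `DV (Ψ w)`. The difference of the two is the
coordinate expression of `(L_V Ψ) w` (`lieDerivTensor_eq`), hence zero. So `Ψ^C ∘ dβ_V = dβ_V ∘ Ψ`:
the induced tensor is `Ψ` transported by `β_V`, and it inherits smoothness and the metallic
equation. Uniqueness is injectivity of the differential of the inclusion. -/

open scoped Topology

/-! ### Coordinate expressions of vector fields, brackets and Lie derivatives -/

section VectorFieldsInCharts

variable {n : ℕ} {M : Type*} [TopologicalSpace M] [ChartedSpace (EuclideanSpace ℝ (Fin n)) M]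
  [IsManifold (𝓡 n) ∞ M]

/-- A tangent vector at a point of a Hausdorff manifold is the value of a global smooth vector
field. -/
theorem exists_smoothVectorField_eq [T2Space M] (x : M) (v : TangentSpace (𝓡 n) x) :
    ∃ X : SmoothVectorField n M, X x = v := by
  obtain ⟨s, hs, hσ⟩ := FiberBundle.exists_contMDiffOn_extend (k := ∞) (𝓡 n)
    (EuclideanSpace ℝ (Fin n)) v
  -- The local extension is cut off by a bump function supported where it is smooth; this is where
  -- the Hausdorff property enters.
  obtain ⟨f, -, hf⟩ := ((SmoothBumpFunction.nhds_basis_tsupport (I := 𝓡 n) x).mem_iff).1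
    (interior_mem_nhds.2 hs)
  refine ⟨⟨_, ContMDiffOn.smul_section_of_tsupport f.contMDiff.contMDiffOn isOpen_interior hf
    (hσ.mono interior_subset)⟩, ?_⟩
  change f x • FiberBundle.extend (EuclideanSpace ℝ (Fin n)) v x = v
  rw [f.eq_one, one_smul, FiberBundle.extend_apply_self]

/-- The components of the vector field `X` in the preferred chart at `x`, as a function of the
coordinates of that chart. -/
noncomputable def vectorComponents (X : ∀ y : M, TangentSpace (𝓡 n) y) (x : M) :
    EuclideanSpace ℝ (Fin n) → EuclideanSpace ℝ (Fin n) :=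
  VectorField.mpullbackWithin 𝓘(ℝ, EuclideanSpace ℝ (Fin n)) (𝓡 n) (extChartAt (𝓡 n) x).symm X
    (range (𝓡 n))

/-- Links the pullback used to define Lie brackets with the trivialization used for tensor
components and for the charts of `TM`: the differentials of the chart and of its inverse are
mutually inverse. -/
theorem vectorComponents_eq_continuousLinearMapAt (X : ∀ y : M, TangentSpace (𝓡 n) y) (x : M)
    {z : EuclideanSpace ℝ (Fin n)} (hz : z ∈ (extChartAt (𝓡 n) x).target) :
    vectorComponents X x z =
      (trivializationAt (EuclideanSpace ℝ (Fin n)) (TangentSpace (𝓡 n) : M → Type _)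
        x).continuousLinearMapAt ℝ ((extChartAt (𝓡 n) x).symm z)
        (X ((extChartAt (𝓡 n) x).symm z)) := by
  have : IsManifold (𝓡 n) 1 M := IsManifold.of_le (n := ∞) (by simp)
  have hs := (extChartAt (𝓡 n) x).map_target hz
  rw [extChartAt_source] at hs
  rw [vectorComponents, VectorField.mpullbackWithin_apply,
    TangentBundle.continuousLinearMapAt_trivializationAt hs]
  congr 1
  exact ContinuousLinearMap.inverse_eq
    (mfderivWithin_extChartAt_symm_comp_mfderiv_extChartAt hz)
    (mfderiv_extChartAt_comp_mfderivWithin_extChartAt_symm hz)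

theorem vectorComponents_self (X : ∀ y : M, TangentSpace (𝓡 n) y) (x : M) :
    vectorComponents X x (extChartAt (𝓡 n) x x) = X x := by
  have : IsManifold (𝓡 n) 1 M := IsManifold.of_le (n := ∞) (by simp)
  rw [vectorComponents_eq_continuousLinearMapAt _ _ (mem_extChartAt_target x), extChartAt_to_inv,
    TangentBundle.continuousLinearMapAt_trivializationAt (mem_chart_source _ x),
    mfderiv_extChartAt_self]
  rfl

theorem SmoothVectorField.differentiableAt_vectorComponents (X : SmoothVectorField n M) (x : M) :
    DifferentiableAt ℝ (vectorComponents X x) (extChartAt (𝓡 n) x x) := by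
  have : IsManifold (𝓡 n) 2 M := IsManifold.of_le (n := ∞) ENat.LEInfty.out
  have h : MDifferentiableWithinAt (𝓡 n) (𝓡 n).tangent
      (fun y ↦ (X y : TangentBundle (𝓡 n) M)) univ x :=
    (X.contMDiff.mdifferentiable (by decide) x).mdifferentiableWithinAt
  have h' := h.differentiableWithinAt_mpullbackWithin_vectorField
  rw [preimage_univ, univ_inter] at h'
  exact DifferentiableWithinAt.differentiableAt (f := vectorComponents X x) h'
    (by simp)

/-- The Lie bracket of two vector fields at `x` is computed in the preferred chart at `x`. -/
theorem mlieBracket_eq_fderiv_vectorComponents (X Y : ∀ y : M, TangentSpace (𝓡 n) y) (x : M) :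
    VectorField.mlieBracket (𝓡 n) X Y x =
      fderiv ℝ (vectorComponents Y x) (extChartAt (𝓡 n) x x) (X x) -
        fderiv ℝ (vectorComponents X x) (extChartAt (𝓡 n) x x) (Y x) := by
  have : IsManifold (𝓡 n) 1 M := IsManifold.of_le (n := ∞) (by simp)
  rw [← VectorField.mlieBracketWithin_univ, VectorField.mlieBracketWithin_apply,
    mfderiv_extChartAt_self]
  change (ContinuousLinearMap.id ℝ (EuclideanSpace ℝ (Fin n))).inverse
    (VectorField.lieBracketWithin ℝ (vectorComponents X x) (vectorComponents Y x) _ _) = _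
  rw [ContinuousLinearMap.inverse_id, ContinuousLinearMap.id_apply, preimage_univ, univ_inter, ModelWithCorners.range_eq_univ,
    VectorField.lieBracketWithin_univ, VectorField.lieBracket, vectorComponents_self,
    vectorComponents_self]

theorem tensorComponents_self (Ψ : TensorField11 (𝓡 n) M) (x : M) :
    tensorComponents Ψ x (extChartAt (𝓡 n) x x) = Ψ x := by
  have : IsManifold (𝓡 n) 1 M := IsManifold.of_le (n := ∞) (by simp)
  have hx := mem_chart_source (EuclideanSpace ℝ (Fin n)) x
  simp only [tensorComponents]
  rw [extChartAt_to_inv, ContinuousLinearMap.inCoordinates,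
    TangentBundle.continuousLinearMapAt_trivializationAt hx,
    TangentBundle.symmL_trivializationAt hx, mfderivWithin_range_extChartAt_symm,
    mfderiv_extChartAt_self]
  rfl

theorem IsSmoothTensor.differentiableAt_tensorComponents {Ψ : TensorField11 (𝓡 n) M}
    (hΨ : IsSmoothTensor (𝓡 n) Ψ) (x : M) :
    DifferentiableAt ℝ (tensorComponents Ψ x) (extChartAt (𝓡 n) x x) := by
  have h := ((contMDiffAt_hom_bundle _).1 (hΨ x)).2
  have h' := (h.mdifferentiableAt (by decide)).differentiableWithinAt_writtenInExtChartAt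
  rw [ModelWithCorners.range_eq_univ, differentiableWithinAt_univ] at h'
  exact h'

theorem vectorComponents_tensor_apply (Ψ : TensorField11 (𝓡 n) M)
    (X : ∀ y : M, TangentSpace (𝓡 n) y) (x : M)
    {z : EuclideanSpace ℝ (Fin n)} (hz : z ∈ (extChartAt (𝓡 n) x).target) :
    vectorComponents (fun y ↦ Ψ y (X y)) x z =
      tensorComponents Ψ x z (vectorComponents X x z) := by
  have hs := (extChartAt (𝓡 n) x).map_target hz
  rw [extChartAt_source] at hs
  rw [vectorComponents_eq_continuousLinearMapAt _ x hz,
    vectorComponents_eq_continuousLinearMapAt _ x hz]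
  simp only [tensorComponents, ContinuousLinearMap.inCoordinates]
  change _ = Trivialization.continuousLinearMapAt ℝ _ _ (Ψ _ (Trivialization.symmL ℝ _ _
    (Trivialization.continuousLinearMapAt ℝ _ _ _)))
  rw [Trivialization.symmL_continuousLinearMapAt _ hs]

/-- The coordinate expression of the Lie derivative of a tensor field of type `(1, 1)`. -/
theorem lieDerivTensor_eq {Ψ : TensorField11 (𝓡 n) M} (hΨ : IsSmoothTensor (𝓡 n) Ψ)
    (V X : SmoothVectorField n M) (x : M) :
    lieDerivTensor V Ψ X x =
      fderiv ℝ (tensorComponents Ψ x) (extChartAt (𝓡 n) x x) (V x) (X x) +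
        tensorComponents Ψ x (extChartAt (𝓡 n) x x)
          (fderiv ℝ (vectorComponents V x) (extChartAt (𝓡 n) x x) (X x)) -
        fderiv ℝ (vectorComponents V x) (extChartAt (𝓡 n) x x) (Ψ x (X x)) := by
  have heq : vectorComponents (fun y ↦ Ψ y (X y)) x =ᶠ[𝓝 (extChartAt (𝓡 n) x x)]
      fun z ↦ tensorComponents Ψ x z (vectorComponents X x z) := by
    filter_upwards [extChartAt_target_mem_nhds (I := 𝓡 n) x] with z hz
    exact vectorComponents_tensor_apply Ψ X x hz
  have hd := (hΨ.differentiableAt_tensorComponents x).hasFDerivAt.clm_apply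
    (X.differentiableAt_vectorComponents x).hasFDerivAt
  unfold lieDerivTensor
  rw [mlieBracket_eq_fderiv_vectorComponents,
    mlieBracket_eq_fderiv_vectorComponents, heq.fderiv_eq, hd.fderiv, tensorComponents_self,
    vectorComponents_self]
  set D := fderiv ℝ (vectorComponents V x) (extChartAt (𝓡 n) x x)
  set D' := fderiv ℝ (vectorComponents X x) (extChartAt (𝓡 n) x x)
  set A : EuclideanSpace ℝ (Fin n) →L[ℝ] EuclideanSpace ℝ (Fin n) := Ψ x
  set v : EuclideanSpace ℝ (Fin n) := V x
  set w : EuclideanSpace ℝ (Fin n) := X x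
  set B := fderiv ℝ (tensorComponents Ψ x) (extChartAt (𝓡 n) x x)
  -- The derivative `D'` of `X` enters only through `A (D' v)`, which cancels; the rest depends on
  -- the value of `X` at `x` alone.
  change (A (D' v) + B v w) - D (A w) - A (D' v - D w) = B v w + A (D w) - D (A w)
  rw [map_sub]
  abel

end VectorFieldsInCharts

/-! ### The cross-section and its induced tensor -/

section CrossSections

variable {n : ℕ} {M : Type*} [TopologicalSpace M] [ChartedSpace (EuclideanSpace ℝ (Fin n)) M]
  [IsManifold (𝓡 n) ∞ M]

/-- The differential of the inclusion `β_V(M) ⊆ TM` in induced coordinates. -/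
theorem crossInclusionDeriv_apply (V : SmoothVectorField n M) (q : CrossSection V)
    (w : EuclideanSpace ℝ (Fin n)) :
    crossInclusionDeriv V q w =
      ((w, fderiv ℝ (vectorComponents V q.1.proj)
        (extChartAt (𝓡 n) q.1.proj q.1.proj) w) :
        EuclideanSpace ℝ (Fin n) × EuclideanSpace ℝ (Fin n)) := by
  obtain ⟨_, x, rfl⟩ := q
  set q : CrossSection V := ⟨crossMap V x, mem_range_self x⟩
  set D := fderiv ℝ (vectorComponents V x) (extChartAt (𝓡 n) x x)
  have hD : HasFDerivAt (fun z ↦ (z, vectorComponents V x z))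
      ((ContinuousLinearMap.id ℝ (EuclideanSpace ℝ (Fin n))).prod D) (extChartAt (𝓡 n) x x) :=
    (hasFDerivAt_id _).prodMk (V.differentiableAt_vectorComponents x).hasFDerivAt
  have h : HasMFDerivAt (𝓡 n) (𝓡 n).tangent
      (Subtype.val : CrossSection V → TangentBundle (𝓡 n) M) q
      ((ContinuousLinearMap.id ℝ (EuclideanSpace ℝ (Fin n))).prod D) := by
    refine ⟨continuous_subtype_val.continuousAt, ?_⟩
    -- Read in the charts, the inclusion is `z ↦ (z, V(z))` near the base point.
    refine HasFDerivAt.hasFDerivWithinAt (E := EuclideanSpace ℝ (Fin n))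
      (F := EuclideanSpace ℝ (Fin n) × EuclideanSpace ℝ (Fin n)) (hD.congr_of_eventuallyEq ?_)
    filter_upwards [extChartAt_target_mem_nhds (I := 𝓡 n) x] with z hz
    have hs := (extChartAt (𝓡 n) x).map_target hz
    rw [extChartAt_source] at hs
    rw [vectorComponents_eq_continuousLinearMapAt _ x hz,
      Trivialization.continuousLinearMapAt_apply_of_mem (R := ℝ) _ hs]
    refine Prod.ext ?_ rfl
    exact (extChartAt (𝓡 n) x).right_inv hz
  rw [crossInclusionDeriv, h.mfderiv]
  rfl

theorem crossInclusionDeriv_injective (V : SmoothVectorField n M) (q : CrossSection V) :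
    Injective (crossInclusionDeriv V q) := by
  intro w w' h
  exact congrArg Prod.fst
    ((crossInclusionDeriv_apply V q w).symm.trans (h.trans (crossInclusionDeriv_apply V q w')))

/-- The tensor field on `β_V(M)` which corresponds to `Ψ` under the diffeomorphism `β_V`. -/
noncomputable def crossTensor (V : SmoothVectorField n M) (Ψ : TensorField11 (𝓡 n) M) :
    TensorField11 (𝓡 n) (CrossSection V) :=
  fun q ↦ (show EuclideanSpace ℝ (Fin n) →L[ℝ] EuclideanSpace ℝ (Fin n) from Ψ q.1.proj)

theorem isInducedTensor_crossTensor [T2Space M] {Ψ : TensorField11 (𝓡 n) M}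
    (hΨ : IsSmoothTensor (𝓡 n) Ψ) (V : SmoothVectorField n M)
    (hV : ∀ (X : SmoothVectorField n M) (x : M), lieDerivTensor V Ψ X x = 0) :
    IsInducedTensor V (completeLift Ψ) (crossTensor V Ψ) := by
  rintro ⟨_, x, rfl⟩ w
  refine (crossInclusionDeriv_apply V _ _).trans (Eq.trans ?_
    (congrArg (completeLift Ψ _) (crossInclusionDeriv_apply V _ w)).symm)
  -- `hV` concerns global fields, so `w` is first extended to one.
  obtain ⟨X, hX⟩ := exists_smoothVectorField_eq x w
  have h := hV X x
  rw [lieDerivTensor_eq hΨ, hX] at h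
  refine Prod.ext ?_ ?_
  · change Ψ x w = tensorComponents Ψ x (extChartAt (𝓡 n) x x) w
    rw [tensorComponents_self]
    rfl
  · exact (sub_eq_zero (G := EuclideanSpace ℝ (Fin n)).1 h).symm

/-- The charts of `β_V(M)` are those of `M` composed with the projection, so in charts this map is
the identity. -/
theorem contMDiff_crossSection_proj (V : SmoothVectorField n M) :
    ContMDiff (𝓡 n) (𝓡 n) ∞ (fun q : CrossSection V ↦ q.1.proj) := by
  intro q
  refine ⟨(crossHomeo V).symm.continuous.continuousAt.continuousWithinAt, ?_⟩
  refine ContDiffAt.contDiffWithinAt (contDiffAt_id.congr_of_eventuallyEq ?_)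
  filter_upwards [extChartAt_target_mem_nhds (I := 𝓡 n) q.1.proj] with z hz
  exact (extChartAt (𝓡 n) q.1.proj).right_inv hz

theorem isSmoothTensor_crossTensor {Ψ : TensorField11 (𝓡 n) M}
    (hΨ : IsSmoothTensor (𝓡 n) Ψ) (V : SmoothVectorField n M) :
    IsSmoothTensor (𝓡 n) (crossTensor V Ψ) := by
  intro q
  have h := ((contMDiffAt_hom_bundle _).1 (hΨ q.1.proj)).2
  refine (contMDiffAt_hom_bundle _).2 ⟨contMDiffAt_id, ?_⟩
  refine (h.comp q (contMDiff_crossSection_proj V q)).congr_of_eventuallyEq ?_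
  have ho := ((crossHomeo V).symm.continuous.continuousAt (x := q)).preimage_mem_nhds
    (chart_source_mem_nhds (EuclideanSpace ℝ (Fin n)) q.1.proj)
  filter_upwards [ho] with p hp
  have hp' : p ∈ (chartAt (EuclideanSpace ℝ (Fin n)) q).source := by
    exact ⟨mem_univ p, hp⟩
  refine (inTangentCoordinates_eq (I := 𝓡 n) (I' := 𝓡 n) (id : CrossSection V → _) id
    (crossTensor V Ψ) hp' hp').trans ?_
  -- Both manifolds have the same coordinate changes, so the components of the two tensors agree
  -- definitionally.
  refine Eq.trans ?_ (inTangentCoordinates_eq (I := 𝓡 n) (I' := 𝓡 n) (id : M → M) id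
    Ψ hp hp).symm
  rfl

end CrossSections

theorem theorem6p2 (n : ℕ) (M : Type*) [TopologicalSpace M] [T2Space M]
    [ChartedSpace (EuclideanSpace ℝ (Fin n)) M] [IsManifold (𝓡 n) ∞ M]
    (a b : ℕ) (Ψ : TensorField11 (𝓡 n) M) (hΨ : IsMetallic (𝓡 n) a b Ψ)
    (V : SmoothVectorField n M)
    (hV : ∀ (X : SmoothVectorField n M) (x : M), lieDerivTensor V Ψ X x = 0) :
    LeavesInvariant V (completeLift Ψ) ∧
      (∃! Φ : TensorField11 (𝓡 n) (CrossSection V), IsInducedTensor V (completeLift Ψ) Φ) ∧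
      ∀ Φ : TensorField11 (𝓡 n) (CrossSection V), IsInducedTensor V (completeLift Ψ) Φ →
        IsMetallic (𝓡 n) a b Φ := by
  have hind := isInducedTensor_crossTensor hΨ.smooth V hV
  have huniq : ∀ Φ : TensorField11 (𝓡 n) (CrossSection V),
      IsInducedTensor V (completeLift Ψ) Φ → Φ = crossTensor V Ψ := by
    intro Φ hΦ
    funext q
    refine ContinuousLinearMap.ext fun w ↦ crossInclusionDeriv_injective V q ?_
    rw [hΦ q w, hind q w]
  refine ⟨?_, ⟨crossTensor V Ψ, hind, huniq⟩, ?_⟩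
  · rintro q _ ⟨w, rfl⟩
    exact ⟨crossTensor V Ψ q w, hind q w⟩
  · intro Φ hΦ
    rw [huniq Φ hΦ]
    exact ⟨hΨ.pos_a, hΨ.pos_b, isSmoothTensor_crossTensor hΨ.smooth V,
      fun q ↦ hΨ.eq_zero q.1.proj⟩
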